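/- Let $B$ and $D$ be (complex, not necessarily unital) C*-algebras and let $\pi\colon B\to D$ be a surjective $*$-homomorphism. Then there is a norm-continuous map $s\colon D\to B$ (not necessarily linear) with $\pi(s(d))=d$ for all $d\in D$ which is 1. contractive: $\|s(d)\|\le\|d\|$ for all $d\in D$; moreover, if $D\neq 0$, then $s$ has norm exactly $1$, i.e. $1$ is the least real number $C$ such that $\|s(d)\|\le C\|d\|$ for all $d\in D$; 2. unital if $\pi$ is unital: if $B$ and $D$ are unital, $D\ne 0$ and $\pi(1_B)=1_D$, then $s(1_D)=1_B$; 3. selfadjoint: $s(d^*)=s(d)^*$ for all $d\in D$; 4. positive: $s(d)\ge 0$ whenever $d\ge 0$. Moreover, let $G$ be a compact topological group acting on $B$ and on $D$ by $*$-automorphisms such that the orbit maps $g\mapsto g\cdot b$ and $g\mapsto g\cdot d$ are norm-continuous for all $b\in B$, $d\in D$, and suppose that $\pi(g\cdot b)=g\cdot\pi(b)$ for all $g\in G$, $b\in B$. Then there is a continuous section $s$ of $\pi$ with all the properties 1--4 which is also equivariant: $s(g\cdot d)=g\cdot s(d)$ for all $g\in G$, $d\in D$. -/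

import Mathlib

/-- `e` is the (two-sided) identity element of the possibly non-unital algebra `A`. An algebra is
unital when such an `e` exists; it is then unique. -/
def IsIdentityElement {A : Type*} [Mul A] (e : A) : Prop :=
  ∀ a : A, e * a = a ∧ a * e = a

/-- An action of a topological group `G` on a C⋆-algebra `A` by ⋆-automorphisms makes `A` a
`G`-algebra when all orbit maps `g ↦ g • a` are norm-continuous (`A` has the norm topology). -/
def IsGAlgebraAction {G A : Type*} [Group G] [TopologicalSpace G] [NonUnitalCStarAlgebra A]
    (α : G →* (A ≃⋆ₐ[ℂ] A)) : Prop :=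
  ∀ a : A, Continuous fun g : G => α g a

/-- `s : D → B` (a map of sets, not assumed linear) is a continuous section of `π : B → D` that is
contractive, of norm exactly one, unital if `π` is unital, selfadjoint and positive. -/
structure IsContractivePositiveSection {B D : Type*}
    [NonUnitalCStarAlgebra B] [PartialOrder B] [NonUnitalCStarAlgebra D] [PartialOrder D]
    (π : B →⋆ₙₐ[ℂ] D) (s : D → B) : Prop where
  /-- `s` is a section of `π`. -/
  isSection : ∀ d : D, π (s d) = d
  /-- `s` is norm-continuous. -/
  continuous : Continuous s
  /-- `s` is contractive. -/
  contractive : ∀ d : D, ‖s d‖ ≤ ‖d‖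
  /-- If `D ≠ 0`, the norm of `s`, the least `C` with `‖s d‖ ≤ C ‖d‖` for all `d`, equals one. -/
  norm_eq_one : Nontrivial D → IsLeast {C : ℝ | ∀ d : D, ‖s d‖ ≤ C * ‖d‖} 1
  /-- If `B` and `D` are unital, `D ≠ 0` and `π 1 = 1`, then `s 1 = 1`. -/
  unital : Nontrivial D → ∀ (e : B) (f : D), IsIdentityElement e → IsIdentityElement f →
    π e = f → s f = e
  /-- `s` is selfadjoint. -/
  selfadjoint : ∀ d : D, s (star d) = star (s d)
  /-- `s` is positive. -/
  positive : ∀ d : D, 0 ≤ d → 0 ≤ s d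

/-!
The Bartle–Graves theorem gives a continuous section of `π` mapping `0` to `0` and `1` to `1`. It is
corrected by operations that are natural in the algebra, hence compatible with `π`: absolute
values make it positive; rescaling the retraction `y ↦ y min(1, |y|⁻¹)` onto the unit ball,
which fixes the ball pointwise, makes it contractive; and averaging with `d ↦ s(d*)*` makes it
selfadjoint. The properties 1–4 pass to averages of sections, so averaging the translates
`d ↦ g · s(g⁻¹ · d)` over Haar measure yields an equivariant section.
-/

open Filter Topology Set MeasureTheory Measure
open scoped CStarAlgebra

section BartleGraves

variable {X E F : Type*} [TopologicalSpace X] [NormalSpace X] [ParacompactSpace X]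

theorem exists_continuousMap_approx_lift
    [SeminormedAddCommGroup E] [NormedSpace ℝ E] [SeminormedAddCommGroup F] [NormedSpace ℝ F]
    (π : E →L[ℝ] F) {C : ℝ} (hC : 0 < C) (hπ : ∀ y, ∃ x, π x = y ∧ ‖x‖ ≤ C * ‖y‖)
    (f : C(X, F)) {ε : ℝ} (hε : 0 < ε) :
    ∃ g : C(X, E), ∀ x, ‖f x - π (g x)‖ < ε ∧ ‖g x‖ < C * (‖f x‖ + ε) := by
  refine exists_continuous_forall_mem_convex_of_local_const
    (t := fun x => {b | ‖f x - π b‖ < ε ∧ ‖b‖ < C * (‖f x‖ + ε)}) (fun x => ?_) fun x => ?_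
  · have hball : {b | ‖f x - π b‖ < ε ∧ ‖b‖ < C * (‖f x‖ + ε)}
        = π ⁻¹' Metric.ball (f x) ε ∩ Metric.ball 0 (C * (‖f x‖ + ε)) := by
      ext b
      simp [dist_eq_norm, norm_sub_rev]
    rw [hball]
    exact ((convex_ball (f x) ε).linear_preimage π.toLinearMap).inter (convex_ball _ _)
  · obtain ⟨b, hb, hbn⟩ := hπ (f x)
    have herr : ∀ᶠ y in 𝓝 x, ‖f y - π b‖ < ε :=
      ContinuousAt.eventually_lt (by fun_prop) continuousAt_const (by simpa [hb] using hε)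
    have hsize : ∀ᶠ y in 𝓝 x, ‖b‖ < C * (‖f y‖ + ε) :=
      continuousAt_const.eventually_lt (by fun_prop) (by nlinarith)
    exact ⟨b, herr.and hsize⟩

theorem exists_seq_continuousMap_approx_lift
    [SeminormedAddCommGroup E] [NormedSpace ℝ E] [SeminormedAddCommGroup F] [NormedSpace ℝ F]
    (π : E →L[ℝ] F) {C : ℝ} (hC : 0 < C) (hπ : ∀ y, ∃ x, π x = y ∧ ‖x‖ ≤ C * ‖y‖)
    (f : C(X, F)) :
    ∃ h : ℕ → C(X, E), ∀ n x, ‖f x - π (h n x)‖ ≤ (1 / 2) ^ n ∧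
      dist (h n x) (h (n + 1) x) ≤ 2 * C * (1 / 2) ^ n := by
  have refine_approx (n : ℕ) (h : C(X, E)) (hh : ∀ x, ‖f x - π (h x)‖ ≤ (1 / 2) ^ n) :
      ∃ h' : C(X, E), (∀ x, ‖f x - π (h' x)‖ ≤ (1 / 2) ^ (n + 1)) ∧
        ∀ x, dist (h x) (h' x) ≤ 2 * C * (1 / 2) ^ n := by
    obtain ⟨g, hg⟩ := exists_continuousMap_approx_lift π hC hπ
      (f - (⟨π, π.continuous⟩ : C(E, F)).comp h) (ε := (1 / 2) ^ (n + 1)) (by positivity)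
    refine ⟨h + g, fun x => ?_, fun x => ?_⟩
    · simpa [sub_sub] using (hg x).1.le
    · have hle : (1 / 2 : ℝ) ^ (n + 1) ≤ (1 / 2) ^ n :=
        pow_le_pow_of_le_one (by norm_num) (by norm_num) n.le_succ
      calc dist (h x) ((h + g) x) = ‖g x‖ := by simp
        _ ≤ C * (‖f x - π (h x)‖ + (1 / 2) ^ (n + 1)) := (hg x).2.le
        _ ≤ C * ((1 / 2) ^ n + (1 / 2) ^ n) := by gcongr; exact hh x
        _ = 2 * C * (1 / 2) ^ n := by ring
  obtain ⟨h₀, hh₀⟩ := exists_continuousMap_approx_lift π hC hπ f one_pos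
  choose! next hnext using refine_approx
  let h : ℕ → C(X, E) := fun n => Nat.rec h₀ next n
  have happrox (n : ℕ) : ∀ x, ‖f x - π (h n x)‖ ≤ (1 / 2) ^ n := by
    induction n with
    | zero => exact fun x => (hh₀ x).1.le.trans_eq (pow_zero _).symm
    | succ n ih => exact (hnext n (h n) ih).1
  exact ⟨h, fun n x => ⟨happrox n x, (hnext n (h n) (happrox n)).2 x⟩⟩

variable [NormedAddCommGroup E] [NormedSpace ℝ E] [CompleteSpace E]
  [NormedAddCommGroup F] [NormedSpace ℝ F] [CompleteSpace F]

/-- The **Bartle–Graves theorem**. -/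
theorem exists_continuousMap_lift (π : E →L[ℝ] F) (hπ : Function.Surjective π) (f : C(X, F)) :
    ∃ g : C(X, E), ∀ x, π (g x) = f x := by
  obtain ⟨C, hC, hpre⟩ := π.exists_preimage_norm_le hπ
  obtain ⟨h, hh⟩ := exists_seq_continuousMap_approx_lift π hC hpre f
  have hhalf : (1 / 2 : ℝ) < 1 := by norm_num
  have hpow : Tendsto (fun n : ℕ => (1 / 2 : ℝ) ^ n) atTop (𝓝 0) :=
    tendsto_pow_atTop_nhds_zero_of_lt_one (by norm_num) hhalf
  choose g hg using fun x => cauchySeq_tendsto_of_complete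
    (cauchySeq_of_le_geometric _ _ hhalf fun n => (hh n x).2)
  have hunif : TendstoUniformly (fun n x => h n x) g atTop := by
    refine Metric.tendstoUniformly_iff.2 fun ε hε => ?_
    have hbound : Tendsto (fun n : ℕ => 2 * C * (1 / 2 : ℝ) ^ n / (1 - 1 / 2)) atTop (𝓝 0) := by
      simpa using (hpow.const_mul (2 * C)).div_const (1 - 1 / 2)
    filter_upwards [hbound.eventually_lt_const hε] with n hn x
    rw [dist_comm]
    exact (dist_le_of_le_geometric_of_tendsto _ _ hhalf (fun n => (hh n x).2) (hg x) n).trans_lt hn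
  refine ⟨⟨g, hunif.continuous (.of_forall fun n => (h n).continuous)⟩, fun x => ?_⟩
  have herr : Tendsto (fun n => f x - π (h n x)) atTop (𝓝 0) :=
    squeeze_zero_norm (fun n => (hh n x).1) hpow
  have hlim : Tendsto (fun n => f x - π (h n x)) atTop (𝓝 (f x - π (g x))) :=
    tendsto_const_nhds.sub ((π.continuous.tendsto _).comp (hg x))
  exact (sub_eq_zero.1 (tendsto_nhds_unique hlim herr)).symm

theorem exists_continuous_section_map_zero_map_eq (π : E →L[ℝ] F) (hπ : Function.Surjective π)
    (x₀ : E) (hx₀ : π x₀ = 0 → x₀ = 0) :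
    ∃ s : F → E, Continuous s ∧ (∀ y, π (s y) = y) ∧ s 0 = 0 ∧ s (π x₀) = x₀ := by
  obtain ⟨t, ht⟩ := exists_continuousMap_lift π hπ (.id F)
  replace ht : ∀ y, π (t y) = y := ht
  -- If `π x₀ = 0`, then `x₀ = 0` and the quotient below has the junk value `0`.
  refine ⟨fun y => t y - t 0 + (‖y‖ / ‖π x₀‖) • (x₀ - (t (π x₀) - t 0)), by fun_prop,
    fun y => by simp [ht], by simp, ?_⟩
  by_cases h : π x₀ = 0
  · simp [hx₀ h]
  · simp [h]

end BartleGraves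

section NormedGroup

variable {E F : Type*} [NormedAddCommGroup F]

theorem isLeast_bound_one_of_section [SeminormedAddCommGroup E] [Nontrivial F]
    {π : E → F} (hπ : ∀ x, ‖π x‖ ≤ ‖x‖) {s : F → E} (hs : ∀ y, π (s y) = y)
    (hle : ∀ y, ‖s y‖ ≤ ‖y‖) :
    IsLeast {C : ℝ | ∀ y, ‖s y‖ ≤ C * ‖y‖} 1 := by
  refine ⟨fun y => by simpa using hle y, fun C hC => ?_⟩
  obtain ⟨y, hy⟩ := exists_ne (0 : F)
  refine le_of_mul_le_mul_right ?_ (norm_pos_iff.2 hy)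
  calc 1 * ‖y‖ = ‖π (s y)‖ := by rw [hs, one_mul]
    _ ≤ ‖s y‖ := hπ _
    _ ≤ C * ‖y‖ := hC y

theorem continuous_norm_smul_of_norm_le_one [SeminormedAddCommGroup E] [NormedSpace ℝ E]
    {φ : F → E} (hφ : ContinuousOn φ {0}ᶜ) (hle : ∀ y, ‖φ y‖ ≤ 1) :
    Continuous fun y => ‖y‖ • φ y := by
  refine continuous_iff_continuousAt.2 fun y => ?_
  rcases eq_or_ne y 0 with rfl | hy
  · rw [ContinuousAt, norm_zero, zero_smul]
    refine squeeze_zero_norm (fun y => ?_) (by simpa using (continuous_norm (E := F)).tendsto 0)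
    rw [norm_smul, norm_norm]
    exact mul_le_of_le_one_right (norm_nonneg y) (hle y)
  · exact continuous_norm.continuousAt.smul (hφ.continuousAt (isOpen_compl_singleton.mem_nhds hy))

end NormedGroup

/-- The function `t ↦ 1 - 1 / max 1 √t`, so that `y ↦ y - y * excess (star y * y)` cuts `y` off at
norm one. It vanishes at `0`, as the non-unital functional calculus requires. -/
noncomputable def excess (t : ℝ) : ℝ := 1 - (max 1 √t)⁻¹

theorem continuous_excess : Continuous excess :=
  continuous_const.sub <| Continuous.inv₀ (by fun_prop) fun _ =>
    (one_pos.trans_le (le_max_left _ _)).ne'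

theorem excess_of_le_one {t : ℝ} (ht : t ≤ 1) : excess t = 0 := by
  simp [excess, max_eq_left (Real.sqrt_le_one.2 ht)]

theorem excess_zero : excess 0 = 0 := excess_of_le_one zero_le_one

theorem excess_le_one (t : ℝ) : excess t ≤ 1 :=
  sub_le_self 1 (by positivity)

theorem mul_one_sub_excess_sq_le_one (t : ℝ) : t * (1 - excess t) ^ 2 ≤ 1 := by
  have hsq : t ≤ max 1 √t ^ 2 := by
    rw [← Real.sqrt_le_left (by positivity)]
    exact le_max_right _ _
  rw [excess, sub_sub_cancel, inv_pow, ← div_eq_mul_inv]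
  exact div_le_one_of_le₀ hsq (by positivity)

section UnitBallRetraction

variable {A B : Type*} [NonUnitalCStarAlgebra A] [NonUnitalCStarAlgebra B]

theorem quasispectrum_star_mul_self_nonneg (y : A) {t : ℝ}
    (ht : t ∈ quasispectrum ℝ (star y * y)) : 0 ≤ t := by
  let _ := CStarAlgebra.spectralOrder A
  have _ := CStarAlgebra.spectralOrderedRing A
  exact quasispectrum_nonneg_of_nonneg _ (star_mul_self_nonneg y) t ht

theorem star_mul_self_sub_mul_cfcₙ {k : ℝ → ℝ} (hk : Continuous k) (hk₀ : k 0 = 0) (y : A) :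
    star (y - y * cfcₙ k (star y * y)) * (y - y * cfcₙ k (star y * y))
      = cfcₙ (fun t => t * (1 - k t) ^ 2) (star y * y) := by
  set a := star y * y with ha
  set c := cfcₙ k a
  have hcs : star c = c := (cfcₙ_predicate k a : IsSelfAdjoint c)
  have hida : cfcₙ (fun t : ℝ => t) a = a := cfcₙ_id' ℝ a
  have hac : cfcₙ (fun t => t * k t) a = a * c := by
    rw [cfcₙ_mul (fun t => t) k a, hida]
  have hca : cfcₙ (fun t => k t * t) a = c * a := by
    rw [cfcₙ_mul k (fun t => t) a, hida]
  have hcac : cfcₙ (fun t => k t * t * k t) a = c * a * c := by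
    rw [cfcₙ_mul (fun t => k t * t) k a (by fun_prop) (by simp), hca]
  calc star (y - y * c) * (y - y * c) = a - a * c - (c * a - c * a * c) := by
        simp only [star_sub, star_mul, hcs, sub_mul, mul_sub, ha, mul_assoc]
        abel
    _ = cfcₙ (fun t => t - t * k t - (k t * t - k t * t * k t)) a := by
        rw [cfcₙ_sub (fun t => t - t * k t) (fun t => k t * t - k t * t * k t) a
            (by fun_prop) (by simp) (by fun_prop) (by simp),
          cfcₙ_sub (fun t => t) (fun t => t * k t) a
            (by fun_prop) (by simp) (by fun_prop) (by simp),
          cfcₙ_sub (fun t => k t * t) (fun t => k t * t * k t) a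
            (by fun_prop) (by simp) (by fun_prop) (by simp), hida, hac, hca, hcac]
    _ = cfcₙ (fun t => t * (1 - k t) ^ 2) a := by
        congr! 2 with t
        ring

/-- The retraction `y ↦ y min(1, |y|⁻¹)` of a C⋆-algebra onto its closed unit ball, with
`min(1, |y|⁻¹) = 1 - excess (|y|²)` expanded so that no unit is needed. -/
noncomputable def unitBallRetraction (y : A) : A := y - y * cfcₙ excess (star y * y)

theorem continuous_unitBallRetraction : Continuous (unitBallRetraction : A → A) := by
  have hcfc : Continuous fun y : A => cfcₙ excess (star y * y) :=
    Continuous.cfcₙ_of_mem_nhdsSet (s := univ) excess univ_mem (by fun_prop)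
      (fun y => IsSelfAdjoint.star_mul_self y) continuous_excess.continuousOn excess_zero
  unfold unitBallRetraction
  fun_prop

theorem map_unitBallRetraction (π : A →⋆ₙₐ[ℂ] B) (y : A) :
    π (unitBallRetraction y) = unitBallRetraction (π y) := by
  have hstar : π (star y * y) = star (π y) * π y := by rw [map_mul, map_star]
  have hcfc : π (cfcₙ excess (star y * y)) = cfcₙ excess (π (star y * y)) :=
    π.map_cfcₙ excess _ continuous_excess.continuousOn excess_zero (map_continuous π)
      (.star_mul_self y) ((IsSelfAdjoint.star_mul_self y).map π)
  rw [unitBallRetraction, map_sub, map_mul, hcfc, hstar, unitBallRetraction]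

theorem norm_unitBallRetraction_le_one (y : A) : ‖unitBallRetraction y‖ ≤ 1 := by
  rw [← sq_le_one_iff₀ (norm_nonneg _), sq, ← CStarRing.norm_star_mul_self, unitBallRetraction,
    star_mul_self_sub_mul_cfcₙ continuous_excess excess_zero]
  refine norm_cfcₙ_le fun t ht => ?_
  have ht₀ := quasispectrum_star_mul_self_nonneg y ht
  rw [Real.norm_of_nonneg (by positivity)]
  exact mul_one_sub_excess_sq_le_one t

theorem unitBallRetraction_of_norm_le_one {y : A} (hy : ‖y‖ ≤ 1) : unitBallRetraction y = y := by
  have hzero : EqOn excess (fun _ => 0) (quasispectrum ℝ (star y * y)) := fun t ht => by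
    refine excess_of_le_one ?_
    calc t ≤ ‖t‖ := Real.le_norm_self t
      _ ≤ ‖star y * y‖ :=
        NonUnitalIsometricContinuousFunctionalCalculus.norm_quasispectrum_le
          _ ht (IsSelfAdjoint.star_mul_self y)
      _ = ‖y‖ * ‖y‖ := CStarRing.norm_star_mul_self
      _ ≤ 1 := mul_le_one₀ hy (norm_nonneg y) hy
  rw [unitBallRetraction, cfcₙ_congr hzero, cfcₙ_const_zero ℝ, mul_zero, sub_zero]

theorem unitBallRetraction_eq_cfcₙ {y : A} (hy : IsSelfAdjoint y) :
    unitBallRetraction y = cfcₙ (fun t : ℝ => t - t * excess (t * t)) y := by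
  have hk := continuous_excess
  have hk₀ : excess (0 * 0) = 0 := by rw [mul_zero, excess_zero]
  have hid : cfcₙ (fun t : ℝ => t) y = y := cfcₙ_id' ℝ y
  have hsq : star y * y = cfcₙ (fun t : ℝ => t * t) y := by
    rw [cfcₙ_mul (fun t : ℝ => t) (fun t : ℝ => t) y, hid, hy.star_eq]
  have hcomp : cfcₙ excess (star y * y) = cfcₙ (fun t => excess (t * t)) y := by
    rw [hsq, ← cfcₙ_comp' excess (fun t : ℝ => t * t) y hk.continuousOn excess_zero]
  rw [cfcₙ_sub (fun t : ℝ => t) (fun t => t * excess (t * t)) y (by fun_prop) (by simp)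
    (by fun_prop) (by simp), cfcₙ_mul (fun t : ℝ => t) (fun t => excess (t * t)) y (by fun_prop)
    (by simp) (by fun_prop) hk₀, hid, ← hcomp, unitBallRetraction]

theorem unitBallRetraction_nonneg [PartialOrder A] [StarOrderedRing A] {y : A} (hy : 0 ≤ y) :
    0 ≤ unitBallRetraction y := by
  rw [unitBallRetraction_eq_cfcₙ (.of_nonneg hy)]
  refine cfcₙ_nonneg fun t ht => sub_nonneg.2 ?_
  exact mul_le_of_le_one_right (quasispectrum_nonneg_of_nonneg y hy t ht) (excess_le_one _)

end UnitBallRetraction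

namespace IsIdentityElement

theorem eq {A : Type*} [Mul A] {e f : A} (he : IsIdentityElement e) (hf : IsIdentityElement f) :
    e = f :=
  (hf e).2.symm.trans (he f).1

theorem isStarProjection {A : Type*} [Mul A] [StarMul A] {e : A} (he : IsIdentityElement e) :
    IsStarProjection e where
  isIdempotentElem := (he e).1
  isSelfAdjoint := by
    have h : star (e * star e) = star (star e) := congrArg star (he (star e)).1
    rwa [star_mul, star_star, (he (star e)).1] at h

theorem norm_eq_one {A : Type*} [NonUnitalNormedRing A] [StarRing A] [CStarRing A] [Nontrivial A]
    {e : A} (he : IsIdentityElement e) : ‖e‖ = 1 := by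
  have hne : e ≠ 0 := fun h => by
    obtain ⟨a, ha⟩ := exists_ne (0 : A)
    exact ha (by rw [← (he a).1, h, zero_mul])
  have hsq : ‖e‖ * ‖e‖ = ‖e‖ := by
    rw [← CStarRing.norm_star_mul_self, he.isStarProjection.isSelfAdjoint.star_eq, (he e).1]
  exact (mul_eq_right₀ (norm_ne_zero_iff.2 hne)).1 hsq

theorem map_equiv {A B F : Type*} [Mul A] [Mul B] [EquivLike F A B] [MulEquivClass F A B] {e : A}
    (he : IsIdentityElement e) (φ : F) : IsIdentityElement (φ e) := by
  refine (EquivLike.surjective φ).forall.2 fun a => ?_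
  rw [← map_mul, ← map_mul, (he a).1, (he a).2]
  exact ⟨rfl, rfl⟩

end IsIdentityElement

theorem map_cfcAbs {A B : Type*} [NonUnitalCStarAlgebra A] [PartialOrder A] [StarOrderedRing A]
    [NonUnitalCStarAlgebra B] [PartialOrder B] [StarOrderedRing B] (π : A →⋆ₙₐ[ℂ] B) (y : A) :
    π (CFC.abs y) = CFC.abs (π y) := by
  refine (CFC.sqrt_unique ?_ (map_nonneg π (CFC.abs_nonneg y))).symm
  rw [← map_mul, CFC.abs_mul_abs, map_mul, map_star]

/-- The positively homogeneous map that agrees on the unit sphere with `s` followed by the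
retraction onto the unit ball. At `d = 0` the junk value `0⁻¹ = 0` is harmless. -/
noncomputable def normTruncation {B D : Type*} [NonUnitalCStarAlgebra B]
    [SeminormedAddCommGroup D] (s : D → B) (d : D) : B :=
  ‖d‖ • unitBallRetraction (‖d‖⁻¹ • s d)

theorem norm_normTruncation_le {B D : Type*} [NonUnitalCStarAlgebra B]
    [SeminormedAddCommGroup D] (s : D → B) (d : D) : ‖normTruncation s d‖ ≤ ‖d‖ := by
  rw [normTruncation, norm_smul, norm_norm]
  exact mul_le_of_le_one_right (norm_nonneg d) (norm_unitBallRetraction_le_one _)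

/-- The selfadjoint part `d ↦ (s d + (s d*)*) / 2` of a map between ⋆-algebras. -/
noncomputable def starSymmetrization {B D : Type*} [AddCommMonoid B] [Module ℝ B] [Star B]
    [Star D] (s : D → B) (d : D) : B :=
  (2⁻¹ : ℝ) • (s d + star (s (star d)))

section Sections

variable {B D : Type*} [NonUnitalCStarAlgebra B] [PartialOrder B]
  [NonUnitalCStarAlgebra D] [PartialOrder D] {π : B →⋆ₙₐ[ℂ] D}

/-- A continuous positive section of `π`, unital if `π` is: the properties of
`IsContractivePositiveSection` that are available before the norm is under control. -/
structure IsPositiveUnitalSection (π : B →⋆ₙₐ[ℂ] D) (s : D → B) : Prop where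
  isSection : ∀ d : D, π (s d) = d
  continuous : Continuous s
  positive : ∀ d : D, 0 ≤ d → 0 ≤ s d
  unital : Nontrivial D → ∀ (e : B) (f : D), IsIdentityElement e → IsIdentityElement f →
    π e = f → s f = e

variable [StarOrderedRing B]

protected theorem IsPositiveUnitalSection.normTruncation {s : D → B}
    (hs : IsPositiveUnitalSection π s) :
    IsPositiveUnitalSection π (normTruncation s) where
  isSection d := by
    rcases eq_or_ne d 0 with rfl | hd
    · simp [normTruncation]
    · have hd' : ‖d‖ ≠ 0 := norm_ne_zero_iff.2 hd
      have hball : ‖‖d‖⁻¹ • d‖ ≤ 1 := by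
        rw [norm_smul, norm_inv, norm_norm, inv_mul_cancel₀ hd']
      simp only [normTruncation, map_real_smul π (map_continuous π),
        map_unitBallRetraction, hs.isSection]
      rw [unitBallRetraction_of_norm_le_one hball, smul_inv_smul₀ hd']
  continuous := by
    refine continuous_norm_smul_of_norm_le_one ?_ fun d => norm_unitBallRetraction_le_one _
    exact continuous_unitBallRetraction.comp_continuousOn <|
      (continuous_norm.continuousOn.inv₀ fun d hd => norm_ne_zero_iff.2 hd).smul
        hs.continuous.continuousOn
  positive d hd := smul_nonneg (norm_nonneg d) <| unitBallRetraction_nonneg <|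
    smul_nonneg (inv_nonneg.2 (norm_nonneg d)) (hs.positive d hd)
  unital hD e f he hf hef := by
    have hball : ‖e‖ ≤ 1 := he.isStarProjection.norm_le
    rw [normTruncation, hf.norm_eq_one, hs.unital hD e f he hf hef, inv_one, one_smul,
      one_smul, unitBallRetraction_of_norm_le_one hball]

theorem IsContractivePositiveSection.integral {Ω : Type*} [MeasurableSpace Ω] {μ : Measure Ω}
    [IsProbabilityMeasure μ] {s : Ω → D → B} (hs : ∀ ω, IsContractivePositiveSection π (s ω))
    (hmeas : ∀ d, AEStronglyMeasurable (fun ω => s ω d) μ) :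
    IsContractivePositiveSection π fun d => ∫ ω, s ω d ∂μ := by
  have hint (d : D) : Integrable (fun ω => s ω d) μ :=
    .of_bound (hmeas d) ‖d‖ (.of_forall fun ω => (hs ω).contractive d)
  have hsection (d : D) : π (∫ ω, s ω d ∂μ) = d := by
    let P : B →L[ℂ] D := ⟨(π : B →ₗ[ℂ] D), map_continuous π⟩
    have hP (ω : Ω) : P (s ω d) = d := (hs ω).isSection d
    calc π (∫ ω, s ω d ∂μ) = ∫ ω, P (s ω d) ∂μ := (P.integral_comp_comm (hint d)).symm
      _ = d := by simp [hP]
  have hcontr (d : D) : ‖∫ ω, s ω d ∂μ‖ ≤ ‖d‖ := by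
    simpa using norm_integral_le_of_norm_le_const (μ := μ)
      (.of_forall fun ω => (hs ω).contractive d)
  refine ⟨hsection, ?_, hcontr, fun _ => isLeast_bound_one_of_section
    (NonUnitalStarAlgHom.norm_apply_le π) hsection hcontr, fun hD e f he hf hef => ?_, fun d => ?_,
    fun d hd => integral_nonneg fun ω => (hs ω).positive d hd⟩
  · refine continuous_iff_continuousAt.2 fun d₀ => ?_
    have hnear : ∀ᶠ d in 𝓝 d₀, ‖d‖ < ‖d₀‖ + 1 :=
      continuous_norm.continuousAt.eventually_lt continuousAt_const (lt_add_one _)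
    refine continuousAt_of_dominated (.of_forall hmeas) ?_ (integrable_const (‖d₀‖ + 1))
      (.of_forall fun ω => (hs ω).continuous.continuousAt)
    filter_upwards [hnear] with d hd
    exact .of_forall fun ω => ((hs ω).contractive d).trans hd.le
  · simp [(hs _).unital hD e f he hf hef]
  · simp only [(hs _).selfadjoint]
    exact (starL' ℝ (A := B)).toContinuousLinearMap.integral_comp_comm (hint d)

variable [StarOrderedRing D]

theorem exists_isPositiveUnitalSection (hπ : Function.Surjective π) :
    ∃ s : D → B, IsPositiveUnitalSection π s := by
  obtain ⟨x₀, hx₀, hunit⟩ : ∃ x₀ : B, (π x₀ = 0 → x₀ = 0) ∧ (Nontrivial D → ∀ (e : B) (f : D),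
      IsIdentityElement e → IsIdentityElement f → π e = f → x₀ = e) := by
    by_cases h : Nontrivial D ∧
      ∃ (e : B) (f : D), IsIdentityElement e ∧ IsIdentityElement f ∧ π e = f
    · obtain ⟨_, e, f, he, hf, rfl⟩ := h
      have hne : π e ≠ 0 := norm_ne_zero_iff.1 (by simp [hf.norm_eq_one])
      exact ⟨e, fun h => absurd h hne, fun _ e' _ he' _ _ => he.eq he'⟩
    · exact ⟨0, fun _ => rfl, fun hD e f he hf hef => (h ⟨hD, e, f, he, hf, hef⟩).elim⟩
  let P : B →L[ℂ] D := ⟨(π : B →ₗ[ℂ] D), map_continuous π⟩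
  obtain ⟨t, htc, ht, ht₀, htx₀⟩ :=
    exists_continuous_section_map_zero_map_eq (P.restrictScalars ℝ) hπ x₀ hx₀
  replace ht : ∀ d, π (t d) = d := ht
  replace htx₀ : t (π x₀) = x₀ := htx₀
  have habsB : Continuous (CFC.abs : B → B) := CFC.continuous_abs
  have habsD : Continuous (CFC.abs : D → D) := CFC.continuous_abs
  let s : D → B := fun d => CFC.abs (t (CFC.abs d)) + t (d - CFC.abs d)
  have hs_nonneg {d : D} (hd : 0 ≤ d) : s d = CFC.abs (t d) := by
    simp only [s, CFC.abs_of_nonneg d hd, sub_self, ht₀, add_zero]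
  refine ⟨s, fun d => ?_, by fun_prop, fun d hd => ?_, fun hD e f he hf hef => ?_⟩
  · simp [s, map_cfcAbs, ht]
  · exact hs_nonneg hd ▸ CFC.abs_nonneg _
  · obtain rfl := hunit hD e f he hf hef
    rw [hs_nonneg hf.isStarProjection.nonneg, ← hef, htx₀,
      CFC.abs_of_nonneg x₀ he.isStarProjection.nonneg]

theorem IsPositiveUnitalSection.isContractivePositiveSection_starSymmetrization {s : D → B}
    (hs : IsPositiveUnitalSection π s) (hle : ∀ d, ‖s d‖ ≤ ‖d‖) :
    IsContractivePositiveSection π (starSymmetrization s) := by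
  have hsection (d : D) : π (starSymmetrization s d) = d := by
    rw [starSymmetrization, map_real_smul π (map_continuous π), map_add, map_star, hs.isSection,
      hs.isSection, star_star, ← two_smul ℝ d, inv_smul_smul₀ two_ne_zero]
  have hcontr (d : D) : ‖starSymmetrization s d‖ ≤ ‖d‖ :=
    calc ‖starSymmetrization s d‖ ≤ 2⁻¹ * (‖s d‖ + ‖star (s (star d))‖) := by
          rw [starSymmetrization, norm_smul, norm_inv, Real.norm_two]
          gcongr
          exact norm_add_le _ _
      _ ≤ 2⁻¹ * (‖d‖ + ‖d‖) := by
          gcongr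
          · exact hle d
          · simpa only [norm_star] using hle (star d)
      _ = ‖d‖ := by ring
  have hnonneg {d : D} (hd : 0 ≤ d) : starSymmetrization s d = s d := by
    rw [starSymmetrization, hd.star_eq, (hs.positive d hd).star_eq, ← two_smul ℝ,
      inv_smul_smul₀ two_ne_zero]
  exact
    { isSection := hsection
      continuous := by
        have := hs.continuous
        unfold starSymmetrization
        fun_prop
      contractive := hcontr
      norm_eq_one := fun _ => isLeast_bound_one_of_section
        (NonUnitalStarAlgHom.norm_apply_le π) hsection hcontr
      unital := fun hD e f he hf hef => by
        rw [hnonneg hf.isStarProjection.nonneg, hs.unital hD e f he hf hef]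
      selfadjoint := fun d => by simp [starSymmetrization, add_comm]
      positive := fun d hd => hnonneg hd ▸ hs.positive d hd }

theorem exists_isContractivePositiveSection (π : B →⋆ₙₐ[ℂ] D) (hπ : Function.Surjective π) :
    ∃ s : D → B, IsContractivePositiveSection π s := by
  obtain ⟨s, hs⟩ := exists_isPositiveUnitalSection hπ
  exact ⟨_, hs.normTruncation.isContractivePositiveSection_starSymmetrization
    (norm_normTruncation_le s)⟩

end Sections

section Equivariance

variable {G A B D : Type*} [Group G] [NonUnitalCStarAlgebra A] [NonUnitalCStarAlgebra B]
  [NonUnitalCStarAlgebra D]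

theorem IsGAlgebraAction.continuous_apply [TopologicalSpace G] {α : G →* (A ≃⋆ₐ[ℂ] A)}
    (hα : IsGAlgebraAction α) {u : G → A} (hu : Continuous u) : Continuous fun g => α g (u g) := by
  refine continuous_iff_continuousAt.2 fun g₀ => tendsto_iff_dist_tendsto_zero.2 ?_
  have harg : Tendsto (fun g => dist (u g) (u g₀)) (𝓝 g₀) (𝓝 0) :=
    tendsto_iff_dist_tendsto_zero.1 (hu.tendsto g₀)
  have horbit : Tendsto (fun g => dist (α g (u g₀)) (α g₀ (u g₀))) (𝓝 g₀) (𝓝 0) :=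
    tendsto_iff_dist_tendsto_zero.1 ((hα (u g₀)).tendsto g₀)
  refine squeeze_zero (fun _ => dist_nonneg) (fun g => ?_) (by simpa using harg.add horbit)
  calc dist (α g (u g)) (α g₀ (u g₀))
      ≤ dist (α g (u g)) (α g (u g₀)) + dist (α g (u g₀)) (α g₀ (u g₀)) := dist_triangle _ _ _
    _ = dist (u g) (u g₀) + dist (α g (u g₀)) (α g₀ (u g₀)) := by
      rw [(StarAlgEquiv.isometry (α g)).dist_eq]

/-- The translate `g · s` of `s : D → B` under the actions of `G`: it sends `d` to
`g · s (g⁻¹ · d)`, so that `s` is equivariant exactly when it equals all its translates. -/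
def groupTranslate (α : G →* (B ≃⋆ₐ[ℂ] B)) (β : G →* (D ≃⋆ₐ[ℂ] D)) (s : D → B)
    (g : G) (d : D) : B :=
  α g (s (β g⁻¹ d))

theorem groupTranslate_mul_apply (α : G →* (B ≃⋆ₐ[ℂ] B)) (β : G →* (D ≃⋆ₐ[ℂ] D)) (s : D → B)
    (h g : G) (d : D) : groupTranslate α β s (h * g) (β h d) = α h (groupTranslate α β s g d) := by
  have hβ : β (h * g)⁻¹ (β h d) = β g⁻¹ d := by
    change (β (h * g)⁻¹ * β h) d = β g⁻¹ d
    rw [← map_mul, mul_inv_rev, inv_mul_cancel_right]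
  rw [groupTranslate, hβ, map_mul]
  rfl

theorem IsGAlgebraAction.continuous_groupTranslate [TopologicalSpace G] [ContinuousInv G]
    {α : G →* (B ≃⋆ₐ[ℂ] B)} {β : G →* (D ≃⋆ₐ[ℂ] D)} (hα : IsGAlgebraAction α)
    (hβ : IsGAlgebraAction β) {s : D → B} (hs : Continuous s) (d : D) :
    Continuous fun g => groupTranslate α β s g d :=
  hα.continuous_apply (hs.comp ((hβ d).comp continuous_inv))

protected theorem IsContractivePositiveSection.groupTranslate [PartialOrder B] [StarOrderedRing B]
    [PartialOrder D] [StarOrderedRing D] {π : B →⋆ₙₐ[ℂ] D} {s : D → B}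
    (hs : IsContractivePositiveSection π s)
    {α : G →* (B ≃⋆ₐ[ℂ] B)} {β : G →* (D ≃⋆ₐ[ℂ] D)} (hπ : ∀ g b, π (α g b) = β g (π b)) (g : G) :
    IsContractivePositiveSection π (groupTranslate α β s g) := by
  have hsection (d : D) : π (groupTranslate α β s g d) = d := by
    rw [groupTranslate, hπ, hs.isSection]
    change (β g * β g⁻¹) d = d
    rw [← map_mul, mul_inv_cancel, map_one]
    rfl
  have hcontr (d : D) : ‖groupTranslate α β s g d‖ ≤ ‖d‖ :=
    calc ‖groupTranslate α β s g d‖ = ‖s (β g⁻¹ d)‖ := StarAlgEquiv.norm_map (α g) _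
      _ ≤ ‖β g⁻¹ d‖ := hs.contractive _
      _ = ‖d‖ := StarAlgEquiv.norm_map (β g⁻¹) d
  exact
    { isSection := hsection
      continuous := (map_continuous (α g)).comp (hs.continuous.comp (map_continuous (β g⁻¹)))
      contractive := hcontr
      norm_eq_one := fun _ => isLeast_bound_one_of_section
        (NonUnitalStarAlgHom.norm_apply_le π) hsection hcontr
      unital := fun hD e f he hf hef => by
        rw [groupTranslate, (hf.map_equiv (β g⁻¹)).eq hf, hs.unital hD e f he hf hef,
          (he.map_equiv (α g)).eq he]
      selfadjoint := fun d => by simp only [groupTranslate, map_star, hs.selfadjoint]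
      positive := fun d hd => map_nonneg (α g) (hs.positive _ (map_nonneg (β g⁻¹) hd)) }

theorem integral_groupTranslate_equivariant [MeasurableSpace G] [MeasurableMul G] {μ : Measure G}
    [μ.IsMulLeftInvariant] (α : G →* (B ≃⋆ₐ[ℂ] B)) (β : G →* (D ≃⋆ₐ[ℂ] D)) (s : D → B)
    (h : G) (d : D) :
    ∫ g, groupTranslate α β s g (β h d) ∂μ = α h (∫ g, groupTranslate α β s g d ∂μ) := by
  let L : B →ₗᵢ[ℂ] B := ⟨(α h : B →ₗ[ℂ] B), StarAlgEquiv.norm_map (α h)⟩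
  calc ∫ g, groupTranslate α β s g (β h d) ∂μ = ∫ g, groupTranslate α β s (h * g) (β h d) ∂μ :=
        (integral_mul_left_eq_self _ h).symm
    _ = ∫ g, α h (groupTranslate α β s g d) ∂μ := by simp only [groupTranslate_mul_apply]
    _ = α h (∫ g, groupTranslate α β s g d ∂μ) := L.integral_comp_comm _

end Equivariance

theorem theorem3p3 {B D : Type*}
    [NonUnitalCStarAlgebra B] [PartialOrder B] [StarOrderedRing B]
    [NonUnitalCStarAlgebra D] [PartialOrder D] [StarOrderedRing D]
    (π : B →⋆ₙₐ[ℂ] D) (hπ : Function.Surjective π) :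
    (∃ s : D → B, IsContractivePositiveSection π s) ∧
    (∀ (G : Type*) [Group G] [TopologicalSpace G] [IsTopologicalGroup G] [CompactSpace G]
      (α : G →* (B ≃⋆ₐ[ℂ] B)) (β : G →* (D ≃⋆ₐ[ℂ] D)),
      IsGAlgebraAction α → IsGAlgebraAction β →
      (∀ (g : G) (b : B), π (α g b) = β g (π b)) →
      ∃ s : D → B, IsContractivePositiveSection π s ∧
        ∀ (g : G) (d : D), s (β g d) = α g (s d)) := by
  obtain ⟨t, ht⟩ := exists_isContractivePositiveSection π hπ
  refine ⟨⟨t, ht⟩, fun G _ _ _ _ α β hα hβ hαβ => ?_⟩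
  let : MeasurableSpace G := borel G
  have : BorelSpace G := ⟨rfl⟩
  let μ : Measure G := haarMeasure ⊤
  have : IsProbabilityMeasure μ := ⟨haarMeasure_self⟩
  have hcont (d : D) : Continuous fun g => groupTranslate α β t g d :=
    hα.continuous_groupTranslate hβ ht.continuous d
  exact ⟨fun d => ∫ g, groupTranslate α β t g d ∂μ,
    .integral (fun g => ht.groupTranslate hαβ g) fun d =>
      ((hcont d).integrable_of_hasCompactSupport (.of_compactSpace _)).aestronglyMeasurable,
    integral_groupTranslate_equivariant α β t⟩
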